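/- Throughout, digraphs are reflexive (every vertex carries a loop). A *path* of length $k$ is a reflexive digraph $\mathbb{P}$ on $\{0,1,\dots,k\}$ in which, for each $0\le i<k$, at least one of the arcs $(i,i+1)$, $(i+1,i)$ is present, and which has no other arcs except loops; the edge between $i$ and $i+1$ is *symmetric* if both arcs are present. Its word $w(\mathbb{P})=x_1\cdots x_k$ over $\{+,-,*\}$ has $x_{i+1}=*$ if the edge between $i$ and $i+1$ is symmetric, and otherwise $x_{i+1}=+$ if $(i,i+1)$ is an arc and $x_{i+1}=-$ if $(i+1,i)$ is an arc. Put $\overline{+}=-$, $\overline{-}=+$, $\overline{*}=*$; the path $\mathbb{P}$ is *self-dual* if $x_1\cdots x_k=\overline{x_k}\cdots\overline{x_1}$. For a word $W=y_1\cdots y_n$ with $n\ge 3$, the *cycle* $C(W)$ is the reflexive digraph on $\{0,\dots,n-1\}$ whose non-loop arcs are, for $1\le i\le n$ and with indices modulo $n$: $(i-1,i)$ if $y_i=+$, $(i,i-1)$ if $y_i=-$, and both if $y_i=*$. A *$p$-ary polymorphism* ($p\ge1$) of a digraph $\mathbb{G}$ with vertex set $G$ is a map $f:G^p\to G$ such that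 $(f(x_1,\dots,x_p),f(y_1,\dots,y_p))$ is an arc whenever $(x_1,y_1),\dots,(x_p,y_p)$ are arcs; it is *essentially unary* if there are an index $i$ and an arc-preserving map $g:G\to G$ with $f(x_1,\dots,x_p)=g(x_i)$ for all $x_1,\dots,x_p\in G$. The digraph $\mathbb{G}$ is *Słupecki* if all its surjective polymorphisms are essentially unary. **Theorem.** Let $\mathbb{P}$ be a self-dual path of length at least $3$ with at least two symmetric edges. Then the cycle $C(w(\mathbb{P})\,+)$, whose word is $w(\mathbb{P})$ followed by the letter $+$, is Słupecki. -/

import Mathlib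

namespace Slupecki

/-- The alphabet `{+, -, *}`; `star` stands for a symmetric edge. -/
inductive Letter where
  | plus
  | minus
  | star
  deriving DecidableEq

/-- Words on the alphabet `{+, -, *}`. -/
abbrev Word := List Letter

/-- The involution on letters: it exchanges `+` and `-` and fixes `*`. -/
def Letter.dual : Letter → Letter
  | .plus => .minus
  | .minus => .plus
  | .star => .star

/-- The involution on words: `x₁ ⋯ x_k` is sent to `dual x_k ⋯ dual x₁`. -/
def Word.dual (W : Word) : Word := (W.map Letter.dual).reverse

/-- A map between the vertex sets of two digraphs is a homomorphism if it preserves arcs. -/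
def IsHom {V V' : Type*} (G : Digraph V) (H : Digraph V') (f : V → V') : Prop :=
  ∀ x y, G.Adj x y → H.Adj (f x) (f y)

/-- The `k`-th power of a digraph: arcs are taken coordinatewise. -/
def power {V : Type*} (G : Digraph V) (k : ℕ) : Digraph (Fin k → V) where
  Adj x y := ∀ i, G.Adj (x i) (y i)

/-- A `k`-ary polymorphism of `G` is a homomorphism from the `k`-th power of `G` to `G`. -/
def IsPolymorphism {V : Type*} (G : Digraph V) (k : ℕ) (f : (Fin k → V) → V) : Prop :=
  IsHom (power G k) G f

/-- `f` depends on one coordinate only, through an endomorphism of `G`. -/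
def IsEssentiallyUnary {V : Type*} (G : Digraph V) (k : ℕ) (f : (Fin k → V) → V) : Prop :=
  ∃ (i : Fin k) (g : V → V), IsHom G G g ∧ ∀ x, f x = g (x i)

/-- A digraph is Słupecki if all its surjective polymorphisms (of any positive arity) are
essentially unary. -/
def IsSlupecki {V : Type*} (G : Digraph V) : Prop :=
  ∀ (k : ℕ) (f : (Fin k → V) → V), 1 ≤ k → IsPolymorphism G k f → Function.Surjective f →
    IsEssentiallyUnary G k f

/-- A (reflexive) path of length `k` on the vertex set `{0, …, k}`: all loops are present, for each
`i < k` at least one of the arcs `(i, i+1)`, `(i+1, i)` is present, and there are no other arcs. -/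
structure IsPath {k : ℕ} (P : Digraph (Fin (k + 1))) : Prop where
  refl : ∀ u, P.Adj u u
  consecutive : ∀ i : Fin k, P.Adj i.castSucc i.succ ∨ P.Adj i.succ i.castSucc
  no_other : ∀ u v, P.Adj u v → u = v ∨ (v : ℕ) = u + 1 ∨ (u : ℕ) = v + 1

open Classical in
/-- The word `w(P)` of a path `P` of length `k`: the letter at position `i` is `*` if both arcs
between `i` and `i + 1` are present; otherwise it is `+` if `(i, i+1)` is an arc and `-` if
`(i+1, i)` is. -/
noncomputable def pathWord {k : ℕ} (P : Digraph (Fin (k + 1))) : Word :=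
  List.ofFn fun i : Fin k =>
    if P.Adj i.castSucc i.succ ∧ P.Adj i.succ i.castSucc then Letter.star
    else if P.Adj i.castSucc i.succ then Letter.plus
    else Letter.minus

/-- A path is self-dual if its word is fixed by the involution. -/
def IsSelfDual {k : ℕ} (P : Digraph (Fin (k + 1))) : Prop :=
  pathWord P = Word.dual (pathWord P)

/-- The number of symmetric edges of a path. -/
noncomputable def numSymmetricEdges {k : ℕ} (P : Digraph (Fin (k + 1))) : ℕ :=
  (pathWord P).count Letter.star

/-- The (reflexive) cycle `C(W)` associated to a word `W` of length `n`, on the vertex set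
`{0, …, n-1}`: the letter of `W` in (zero-based) position `u` describes the arcs between `u` and
`u + 1` modulo `n`, namely `(u, u+1)` if it is `+`, `(u+1, u)` if it is `-`, and both if it is
`*`; moreover all loops are present. -/
def cycle (W : Word) : Digraph (Fin W.length) where
  Adj u v := u = v ∨
    ((v : ℕ) = (u + 1) % W.length ∧ (W.get u = Letter.plus ∨ W.get u = Letter.star)) ∨
    ((u : ℕ) = (v + 1) % W.length ∧ (W.get v = Letter.minus ∨ W.get v = Letter.star))

end Slupecki

/-!
Let `n ≥ 4` be the length of the cycle. A polymorphism `f` lifts to a homomorphism `F` between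
powers of the universal cover, a two-way infinite path on `ℤ`, and `F` has a degree in every
coordinate. If some degree is nonzero, then `F` moves with slope `±1` in that coordinate; a
symmetric edge then leaves no room for the other coordinates, and `f` is essentially unary.

If all degrees vanish, `F` descends to a homomorphism `H` from a power of the cycle to the cover;
when `f` is onto, `H` takes some minimal value `s` and also a value at least `s + n - 1`. Zigzag
walks, which follow arcs alternately forwards and backwards, exclude this: for a suitable starting
time any two vertices of the cycle, hence of its powers, are joined by a zigzag walk that is too
short to lead from `s` to `s + n - 1` in the cover. Namely, choose the starting time such that the
first non-symmetric edge above `s` is blocked for a walk that reaches it without delay. Since the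
walk has to wait there, it could have started one step later; so if `m` is the shortest length of
a walk from `s` to `s + n - 1`, parts of such a walk, their time shifts and their reversals already
join all vertices of the cycle in `m - 1` steps.
-/

namespace Slupecki

section Cover

/-- The vertex of the cycle of `W` below an integer, that is, its class modulo the length. -/
def residue (W : Word) [NeZero W.length] (a : ℤ) : Fin W.length :=
  ⟨(a % W.length).toNat, by
    have := Int.emod_lt_of_pos a (Int.natCast_pos.2 (NeZero.pos W.length))
    have := Int.emod_nonneg a (Int.natCast_ne_zero.2 (NeZero.ne W.length))
    omega⟩

/-- The letter of the edge between `a` and `a + 1` in the universal cover of the cycle of `W`. -/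
def edge (W : Word) [NeZero W.length] (a : ℤ) : Letter := W.get (residue W a)

/-- The universal cover of the cycle of `W`: a two-way infinite path on `ℤ`. -/
def cover (W : Word) [NeZero W.length] : Digraph ℤ where
  Adj a b := a = b ∨
    (b = a + 1 ∧ (edge W a = .plus ∨ edge W a = .star)) ∨
    (a = b + 1 ∧ (edge W b = .minus ∨ edge W b = .star))

variable {W : Word} [NeZero W.length]

theorem coe_residue (a : ℤ) : ((residue W a : ℕ) : ℤ) = a % W.length :=
  Int.toNat_of_nonneg (Int.emod_nonneg a (Int.natCast_ne_zero.2 (NeZero.ne W.length)))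

theorem residue_eq_iff {a b : ℤ} : residue W a = residue W b ↔ (W.length : ℤ) ∣ b - a := by
  rw [← Int.modEq_iff_dvd, Int.ModEq, ← coe_residue, ← coe_residue, Fin.ext_iff, Int.natCast_inj]

theorem residue_coe (v : Fin W.length) : residue W ((v : ℕ) : ℤ) = v := by
  rw [Fin.ext_iff, ← Int.natCast_inj, coe_residue]
  exact Int.emod_eq_of_lt (by omega) (by omega)

theorem residue_add_mul (a m : ℤ) : residue W (a + m * W.length) = residue W a :=
  residue_eq_iff.2 ⟨-m, by ring⟩

theorem residue_add_congr {a b : ℤ} (h : residue W a = residue W b) (c : ℤ) :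
    residue W (a + c) = residue W (b + c) := by
  rw [residue_eq_iff, add_sub_add_right_eq_sub]
  exact residue_eq_iff.1 h

theorem eq_of_residue_eq {a b : ℤ} (h : residue W a = residue W b) (hab : |b - a| < W.length) :
    a = b :=
  (sub_eq_zero.1 (Int.eq_zero_of_abs_lt_dvd (residue_eq_iff.1 h) hab)).symm

theorem exists_residue_eq (l : ℤ) (v : Fin W.length) :
    ∃ a, l ≤ a ∧ a < l + W.length ∧ residue W a = v := by
  have hn : (0 : ℤ) < W.length := Int.natCast_pos.2 (NeZero.pos W.length)
  refine ⟨l + (v - l) % W.length, ?_, ?_, ?_⟩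
  · linarith [Int.emod_nonneg (v - l) hn.ne']
  · linarith [Int.emod_lt_of_pos (v - l) hn]
  · conv_rhs => rw [← residue_coe v]
    rw [residue_eq_iff]
    convert Int.dvd_self_sub_emod (x := v - l) (m := W.length) using 1
    ring

theorem coe_residue_add_one (a : ℤ) :
    (residue W (a + 1) : ℕ) = ((residue W a : ℕ) + 1) % W.length := by
  rw [← Int.natCast_inj, coe_residue]
  push_cast
  rw [coe_residue, Int.emod_add_emod]

theorem cycle_adj_residue_iff {a b : ℤ} :
    (cycle W).Adj (residue W a) (residue W b) ↔ residue W a = residue W b ∨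
      (residue W b = residue W (a + 1) ∧ (edge W a = .plus ∨ edge W a = .star)) ∨
      (residue W a = residue W (b + 1) ∧ (edge W b = .minus ∨ edge W b = .star)) := by
  simp only [cycle, edge, ← coe_residue_add_one, Fin.ext_iff]

theorem cover_refl (a : ℤ) : (cover W).Adj a a := Or.inl rfl

theorem cover_adj_succ (a : ℤ) : (cover W).Adj a (a + 1) ∨ (cover W).Adj (a + 1) a := by
  cases h : edge W a
  · exact Or.inl (Or.inr (Or.inl ⟨rfl, Or.inl h⟩))
  · exact Or.inr (Or.inr (Or.inr ⟨rfl, Or.inl h⟩))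
  · exact Or.inl (Or.inr (Or.inl ⟨rfl, Or.inr h⟩))

theorem cover_adj_succ_and_iff {a : ℤ} :
    (cover W).Adj a (a + 1) ∧ (cover W).Adj (a + 1) a ↔ edge W a = .star := by
  have : a ≠ a + 1 + 1 := by omega
  cases h : edge W a <;> simp [cover, h, this]

theorem abs_sub_le_of_cover {a b : ℤ} (h : (cover W).Adj a b) : |b - a| ≤ 1 := by
  rcases h with h | h | h <;> rw [abs_le] <;> omega

theorem cover_adj_add_mul {a b : ℤ} (h : (cover W).Adj a b) (m : ℤ) :
    (cover W).Adj (a + m * W.length) (b + m * W.length) := by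
  simp only [cover, edge, residue_add_mul] at h ⊢
  rcases h with rfl | ⟨rfl, h⟩ | ⟨rfl, h⟩
  · exact Or.inl rfl
  · exact Or.inr (Or.inl ⟨by ring, h⟩)
  · exact Or.inr (Or.inr ⟨by ring, h⟩)

theorem isHom_residue : IsHom (cover W) (cycle W) (residue W) := by
  rintro a b (rfl | ⟨rfl, h⟩ | ⟨rfl, h⟩) <;> rw [cycle_adj_residue_iff]
  · exact Or.inl rfl
  · exact Or.inr (Or.inl ⟨rfl, h⟩)
  · exact Or.inr (Or.inr ⟨rfl, h⟩)

theorem exists_cover_adj_add_mul {a b : ℤ} (h : (cycle W).Adj (residue W a) (residue W b)) :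
    ∃ m : ℤ, (cover W).Adj a (b + m * W.length) := by
  rcases cycle_adj_residue_iff.1 h with h | ⟨h, hl⟩ | ⟨h, hl⟩ <;>
    obtain ⟨m, hm⟩ := residue_eq_iff.1 h
  · exact ⟨-m, Or.inl (by linarith)⟩
  · exact ⟨m, Or.inr (Or.inl ⟨by linarith, hl⟩)⟩
  · refine ⟨-m, Or.inr (Or.inr ⟨by linarith, ?_⟩)⟩
    rwa [edge, residue_add_mul]

theorem exists_cover_adj {a : ℤ} {v : Fin W.length} (h : (cycle W).Adj (residue W a) v) :
    ∃ b, (cover W).Adj a b ∧ residue W b = v := by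
  rw [← residue_coe v] at h
  obtain ⟨m, hm⟩ := exists_cover_adj_add_mul h
  exact ⟨_, hm, by rw [residue_add_mul, residue_coe]⟩

theorem cover_adj_of_residue (hW : 4 ≤ W.length) {a b : ℤ}
    (h : (cycle W).Adj (residue W a) (residue W b)) (hab : |b - a| ≤ 2) :
    (cover W).Adj a b := by
  obtain ⟨c, hac, hcb⟩ := exists_cover_adj h
  obtain rfl : c = b := by
    have hca := abs_sub_le_of_cover hac
    refine eq_of_residue_eq hcb ?_
    rw [abs_le] at hab hca
    rw [abs_lt]
    omega
  exact hac

end Cover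

section Lifting

variable {W : Word} [NeZero W.length]

theorem exists_antiderivative {M : Type*} [AddCommGroup M] (g : ℤ → M) (c : M) :
    ∃ q : ℤ → M, q 0 = c ∧ ∀ t, q (t + 1) = q t + g t := by
  refine ⟨fun
    | .ofNat m => c + ∑ i ∈ Finset.range m, g i
    | .negSucc m => c - ∑ i ∈ Finset.range (m + 1), g (-(i + 1)), by simp, ?_⟩
  rintro (m | _ | m)
  · change c + ∑ i ∈ Finset.range (m + 1), g i = c + ∑ i ∈ Finset.range m, g i + g m
    rw [Finset.sum_range_succ, add_assoc]
  · simp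
  · change c - ∑ i ∈ Finset.range (m + 1), g (-(i + 1)) =
      c - ∑ i ∈ Finset.range (m + 1 + 1), g (-(i + 1)) + g (Int.negSucc (m + 1))
    rw [Finset.sum_range_succ _ (m + 1), Int.negSucc_eq]
    abel

theorem exists_path_lift (γ : ℤ → Fin W.length)
    (hγ : ∀ t, (cycle W).Adj (γ t) (γ (t + 1)) ∨ (cycle W).Adj (γ (t + 1)) (γ t))
    {s : ℤ} (hs : residue W s = γ 0) :
    ∃ q : ℤ → ℤ, q 0 = s ∧ (∀ t, residue W (q t) = γ t) ∧ ∀ t, |q (t + 1) - q t| ≤ 1 := by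
  have exists_step : ∀ t, ∃ e : ℤ, residue W ((γ t : ℕ) + e) = γ (t + 1) ∧ |e| ≤ 1 := by
    intro t
    have h := hγ t
    rw [← residue_coe (γ t), ← residue_coe (γ (t + 1))] at h
    rcases h with h | h <;> obtain ⟨m, hm⟩ := exists_cover_adj_add_mul h
    · refine ⟨(γ (t + 1) : ℕ) + m * W.length - (γ t : ℕ), ?_, abs_sub_le_of_cover hm⟩
      rw [add_sub_cancel, residue_add_mul, residue_coe]
    · refine ⟨(γ (t + 1) : ℕ) - ((γ t : ℕ) + m * W.length), ?_, ?_⟩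
      · rw [← residue_add_mul _ m]
        conv_rhs => rw [← residue_coe (γ (t + 1))]
        congr 1
        ring
      · rw [abs_sub_comm]
        exact abs_sub_le_of_cover hm
  choose e he he_le using exists_step
  obtain ⟨q, hq₀, hq⟩ := exists_antiderivative e s
  have residue_succ_iff : ∀ t, residue W (q t) = γ t ↔ residue W (q (t + 1)) = γ (t + 1) := by
    intro t
    rw [← he, hq]
    conv_lhs => rw [← residue_coe (γ t)]
    refine ⟨fun h => residue_add_congr h _, fun h => ?_⟩
    simpa only [add_neg_cancel_right] using residue_add_congr h (-e t)
  refine ⟨q, hq₀, fun t => ?_, fun t => by rw [hq, add_sub_cancel_left]; exact he_le t⟩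
  induction t using Int.induction_on with
  | zero => rw [hq₀, hs]
  | succ i ih => exact (residue_succ_iff _).1 ih
  | pred i ih => exact (residue_succ_iff _).2 (by rwa [sub_add_cancel])

theorem abs_sub_le_one_of_lifts (hW : 4 ≤ W.length) {q q' : ℤ → ℤ}
    (hq : ∀ t, |q (t + 1) - q t| ≤ 1) (hq' : ∀ t, |q' (t + 1) - q' t| ≤ 1)
    (hadj : ∀ s t, (cover W).Adj s t → (cycle W).Adj (residue W (q s)) (residue W (q' t)))
    (h₀ : |q' 0 - q 0| ≤ 1) (t : ℤ) : |q' t - q t| ≤ 1 := by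
  have improve : ∀ {s t}, (cover W).Adj s t → |q' t - q s| ≤ 2 → |q' t - q s| ≤ 1 :=
    fun hst h => abs_sub_le_of_cover (cover_adj_of_residue hW (hadj _ _ hst) h)
  have succ_iff : ∀ t, |q' t - q t| ≤ 1 ↔ |q' (t + 1) - q (t + 1)| ≤ 1 := by
    intro t
    have hqt := hq t
    have hqt' := hq' t
    have h_t := improve (cover_refl t)
    have h_succ := improve (cover_refl (t + 1))
    -- Move the two times one after the other, in the order in which `improve` applies to the
    -- intermediate difference; each move changes the difference by at most `1`.
    rcases cover_adj_succ (W := W) t with h | h <;>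
    · have h_cross := improve h
      simp only [abs_le] at *
      constructor <;> intro _ <;> omega
  induction t using Int.induction_on with
  | zero => exact h₀
  | succ i ih => exact (succ_iff _).1 ih
  | pred i ih => exact (succ_iff _).2 (by rwa [sub_add_cancel])

theorem exists_homotopy_lift (hW : 4 ≤ W.length) {X : Type*} {G : Digraph X}
    (hG : ∀ x, G.Adj x x) {f : X → ℤ → Fin W.length}
    (hf : ∀ {x y s t}, G.Adj x y → (cover W).Adj s t → (cycle W).Adj (f x s) (f y t))
    {F₀ : X → ℤ} (hF₀ : IsHom G (cover W) F₀) (hf₀ : ∀ x, residue W (F₀ x) = f x 0) :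
    ∃ F : X → ℤ → ℤ, (∀ x t, residue W (F x t) = f x t) ∧
      ∀ {x y s t}, G.Adj x y → (cover W).Adj s t → (cover W).Adj (F x s) (F y t) := by
  have exists_line_lift := fun x => exists_path_lift (f x)
    (fun t => (cover_adj_succ t).imp (hf (hG x)) (hf (hG x))) (hf₀ x)
  choose F hF_zero hF_residue hF_step using exists_line_lift
  refine ⟨F, hF_residue, fun {x y s t} hxy hst => ?_⟩
  have hadj : ∀ s t, (cover W).Adj s t →
      (cycle W).Adj (residue W (F x s)) (residue W (F y t)) := fun s t hst => by
    rw [hF_residue, hF_residue]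
    exact hf hxy hst
  have h_parallel : |F y s - F x s| ≤ 1 :=
    abs_sub_le_one_of_lifts hW (hF_step x) (hF_step y) hadj
      (by rw [hF_zero, hF_zero]; exact abs_sub_le_of_cover (hF₀ x y hxy)) s
  have h_along : |F y t - F y s| ≤ 1 := by
    rcases hst with rfl | ⟨rfl, -⟩ | ⟨rfl, -⟩
    · simp
    · exact hF_step y s
    · rw [abs_sub_comm]
      exact hF_step y t
  refine cover_adj_of_residue hW (hadj s t hst) ?_
  rw [abs_le] at *
  omega

theorem exists_lift (hW : 4 ≤ W.length) :
    ∀ {k : ℕ} {f : (Fin k → ℤ) → Fin W.length}, IsHom (power (cover W) k) (cycle W) f →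
      ∃ F : (Fin k → ℤ) → ℤ, IsHom (power (cover W) k) (cover W) F ∧ ∀ x, residue W (F x) = f x
  | 0, f, _ => ⟨fun _ => (f 0 : ℕ), fun _ _ _ => cover_refl _, fun x => by
      rw [residue_coe, Subsingleton.elim x 0]⟩
  | k + 1, f, hf => by
    have hcons : ∀ {x y : Fin k → ℤ} {s t : ℤ}, (power (cover W) k).Adj x y → (cover W).Adj s t →
        (cycle W).Adj (f (Fin.cons s x)) (f (Fin.cons t y)) := fun hxy hst =>
      hf _ _ (Fin.cases hst hxy)
    obtain ⟨F₀, hF₀, hf₀⟩ := exists_lift hW (f := fun x => f (Fin.cons 0 x))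
      fun _ _ hxy => hcons hxy (cover_refl 0)
    obtain ⟨F, hF_residue, hF_hom⟩ :=
      exists_homotopy_lift hW (fun _ _ => cover_refl _) hcons hF₀ hf₀
    refine ⟨fun x => F (Fin.tail x) (x 0), fun x y hxy => ?_, fun x => ?_⟩
    · exact hF_hom (fun i => hxy i.succ) (hxy 0)
    · rw [hF_residue, Fin.cons_self_tail]

end Lifting

section Degree

theorem eq_of_forall_update {k : ℕ} {X α : Type*} {r : X → X → Prop} {φ : (Fin k → X) → α}
    (h : ∀ x i t, r (x i) t → φ (Function.update x i t) = φ x) {x y : Fin k → X}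
    (hxy : ∀ i, r (x i) (y i)) : φ y = φ x := by
  classical
  have eq_piecewise : ∀ s : Finset (Fin k), φ (s.piecewise y x) = φ x := by
    intro s
    induction s using Finset.induction_on with
    | empty => rw [Finset.piecewise_empty]
    | insert a s ha ih =>
      rw [Finset.piecewise_insert, h, ih]
      rw [Finset.piecewise_eq_of_notMem _ _ _ ha]
      exact hxy a
  simpa only [Finset.piecewise_univ] using eq_piecewise Finset.univ

theorem abs_sub_le_of_abs_step_le {q : ℤ → ℤ} {a b : ℤ} (hab : a ≤ b)
    (hq : ∀ t, a ≤ t → t < b → |q (t + 1) - q t| ≤ 1) : |q b - q a| ≤ b - a := by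
  induction b, hab using Int.leInduction with
  | base => simp
  | succ b hab ih =>
    have h_init := ih fun t hat htb => hq t hat (htb.trans (lt_add_one b))
    have h_last := hq b hab (lt_add_one b)
    rw [abs_le] at *
    omega

theorem degree_eq_one_or_neg_one {n : ℕ} (hn : 0 < n) {q : ℤ → ℤ}
    (hq : ∀ t, |q (t + 1) - q t| ≤ 1) {d : ℤ} (hd : d ≠ 0)
    (hdeg : ∀ t, q (t + n) = q t + n * d) : d = 1 ∨ d = -1 := by
  have h_period := abs_sub_le_of_abs_step_le (a := 0) (b := 0 + n) (by omega) fun t _ _ => hq t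
  rw [hdeg, add_sub_cancel_left, add_sub_cancel_left, abs_mul, Nat.abs_cast] at h_period
  have h_le : |d| ≤ 1 := le_of_mul_le_mul_left (by rwa [mul_one]) (Int.natCast_pos.2 hn)
  rw [abs_le] at h_le
  omega

theorem eq_add_mul_of_degree_ne_zero {n : ℕ} (hn : 0 < n) {q : ℤ → ℤ}
    (hq : ∀ t, |q (t + 1) - q t| ≤ 1) {d : ℤ} (hd : d ≠ 0)
    (hdeg : ∀ t, q (t + n) = q t + n * d) (t : ℤ) : q t = q 0 + d * t := by
  have step_eq : ∀ t, q (t + 1) = q t + d := by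
    intro t
    have h_step := hq t
    have h_rest := abs_sub_le_of_abs_step_le (a := t + 1) (b := t + n) (by omega) fun t _ _ => hq t
    rw [hdeg] at h_rest
    rw [abs_le] at h_step h_rest
    rcases degree_eq_one_or_neg_one hn hq hd hdeg with rfl | rfl <;> omega
  induction t using Int.induction_on with
  | zero => simp
  | succ j ih => rw [step_eq, ih]; ring
  | pred j ih =>
    have h_step := step_eq (-j - 1)
    rw [sub_add_cancel, ih] at h_step
    linarith

variable {W : Word} [NeZero W.length] {k : ℕ}

theorem power_cover_refl (x : Fin k → ℤ) : (power (cover W) k).Adj x x :=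
  fun _ => cover_refl _

theorem power_cover_adj_update {x y : Fin k → ℤ} (h : (power (cover W) k).Adj x y)
    (i : Fin k) {s t : ℤ} (hst : (cover W).Adj s t) :
    (power (cover W) k).Adj (Function.update x i s) (Function.update y i t) := by
  intro j
  by_cases hj : j = i
  · subst hj
    simpa only [Function.update_self] using hst
  · simpa only [Function.update_of_ne hj] using h j

theorem eq_of_forall_adj {α : Type*} {φ : (Fin k → ℤ) → α}
    (h : ∀ x y, (power (cover W) k).Adj x y → φ x = φ y) (x y : Fin k → ℤ) : φ x = φ y := by
  refine (eq_of_forall_update (r := fun _ _ => True) (fun x i t _ => ?_) (fun _ => trivial)).symm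
  have update_succ : ∀ t, φ (Function.update x i (t + 1)) = φ (Function.update x i t) := fun t =>
    (cover_adj_succ (W := W) t).elim
      (fun ht => (h _ _ (power_cover_adj_update (power_cover_refl x) i ht)).symm)
      (fun ht => h _ _ (power_cover_adj_update (power_cover_refl x) i ht))
  have update_eq : ∀ t, φ (Function.update x i t) = φ (Function.update x i 0) := by
    intro t
    induction t using Int.induction_on with
    | zero => rfl
    | succ j ih => rw [update_succ, ih]
    | pred j ih => rw [← ih, ← update_succ, sub_add_cancel]
  rw [update_eq t, ← update_eq (x i), Function.update_eq_self]

theorem abs_update_succ_sub_le {F : (Fin k → ℤ) → ℤ} (hF : IsHom (power (cover W) k) (cover W) F)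
    (x : Fin k → ℤ) (i : Fin k) (t : ℤ) :
    |F (Function.update x i (t + 1)) - F (Function.update x i t)| ≤ 1 := by
  rcases cover_adj_succ (W := W) t with h | h
  · exact abs_sub_le_of_cover (hF _ _ (power_cover_adj_update (power_cover_refl x) i h))
  · rw [abs_sub_comm]
    exact abs_sub_le_of_cover (hF _ _ (power_cover_adj_update (power_cover_refl x) i h))

/-- `F` lifts the operation `f` on the cycle to the universal cover. -/
structure IsLift (f : (Fin k → Fin W.length) → Fin W.length) (F : (Fin k → ℤ) → ℤ) : Prop where
  isHom : IsHom (power (cover W) k) (cover W) F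
  residue_apply : ∀ x, residue W (F x) = f fun j => residue W (x j)

variable {f : (Fin k → Fin W.length) → Fin W.length} {F : (Fin k → ℤ) → ℤ}

theorem exists_isLift (hW : 4 ≤ W.length) (hf : IsPolymorphism (cycle W) k f) :
    ∃ F, IsLift f F := by
  obtain ⟨F, hF, hFf⟩ := exists_lift hW (f := fun x => f fun j => residue W (x j))
    fun _ _ hxy => hf _ _ fun j => isHom_residue _ _ (hxy j)
  exact ⟨F, hF, hFf⟩

/-- `d` is the degree of `F` in the coordinate `i`: going once around the cycle in this coordinate
moves `F` by `d` times the length. -/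
def HasDegree (W : Word) (F : (Fin k → ℤ) → ℤ) (i : Fin k) (d : ℤ) : Prop :=
  ∀ x t, F (Function.update x i (t + W.length)) = F (Function.update x i t) + W.length * d

theorem IsLift.exists_degree (hF : IsLift f F) (hW : 2 < W.length) (i : Fin k) :
    ∃ d, HasDegree W F i d := by
  have hdvd : ∀ x, (W.length : ℤ) ∣ F (Function.update x i (x i + W.length)) - F x := by
    intro x
    rw [← residue_eq_iff, hF.residue_apply, hF.residue_apply]
    congr 1
    ext j : 1
    by_cases hj : j = i
    · subst hj
      simpa using (residue_add_mul (W := W) (x j) 1).symm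
    · rw [Function.update_of_ne hj]
  have gain_const : ∀ x y, F (Function.update x i (x i + W.length)) - F x =
      F (Function.update y i (y i + W.length)) - F y := by
    refine eq_of_forall_adj (W := W) fun x y hxy => ?_
    have h_start := abs_sub_le_of_cover (hF.isHom _ _ hxy)
    have h_shift : (cover W).Adj (x i + W.length) (y i + W.length) := by
      simpa only [one_mul] using cover_adj_add_mul (hxy i) 1
    have h_end := abs_sub_le_of_cover (hF.isHom _ _ (power_cover_adj_update hxy i h_shift))
    refine eq_of_sub_eq_zero (Int.eq_zero_of_abs_lt_dvd (dvd_sub (hdvd x) (hdvd y)) ?_)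
    rw [abs_le] at h_start h_end
    rw [abs_lt]
    omega
  obtain ⟨d, hd⟩ := hdvd 0
  refine ⟨d, fun x t => ?_⟩
  have h_gain := gain_const (Function.update x i t) 0
  rw [hd, Function.update_self, Function.update_idem] at h_gain
  linarith

theorem eq_zero_add_mul_of_degree_ne_zero (hF : IsHom (power (cover W) k) (cover W) F) {i : Fin k}
    {d : ℤ} (hd : d ≠ 0) (hdeg : HasDegree W F i d) {s : ℤ} (hs : edge W s = .star)
    (x : Fin k → ℤ) : F x = F 0 + d * x i := by
  have h_one : d = 1 ∨ d = -1 :=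
    degree_eq_one_or_neg_one (q := fun t => F (Function.update 0 i t)) (NeZero.pos W.length)
      (abs_update_succ_sub_le hF 0 i) hd (hdeg 0)
  have h_line : ∀ x t, F (Function.update x i t) = F x - d * x i + d * t := by
    intro x t
    have h := eq_add_mul_of_degree_ne_zero (q := fun t => F (Function.update x i t))
      (NeZero.pos W.length) (abs_update_succ_sub_le hF x i) hd (hdeg x)
    have h_self := h (x i)
    rw [Function.update_eq_self] at h_self
    linarith [h t]
  have offset_const : ∀ x y, F x - d * x i = F y - d * y i := by
    refine eq_of_forall_adj (W := W) fun x y hxy => ?_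
    have h_adj : ∀ {a b : ℤ}, (cover W).Adj a b →
        |F y - d * y i + d * b - (F x - d * x i + d * a)| ≤ 1 := fun {a b} hab => by
      rw [← h_line, ← h_line]
      exact abs_sub_le_of_cover (hF _ _ (power_cover_adj_update hxy i hab))
    obtain ⟨h_up, h_down⟩ := cover_adj_succ_and_iff.2 hs
    have h_up := h_adj h_up
    have h_down := h_adj h_down
    rw [abs_le] at h_up h_down
    rcases h_one with rfl | rfl <;> omega
  have h := offset_const x 0
  rw [Pi.zero_apply] at h
  linarith

theorem IsLift.isEssentiallyUnary (hF : IsLift f F) (hf : IsPolymorphism (cycle W) k f) {i : Fin k}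
    {d : ℤ} (hd : d ≠ 0) (hdeg : HasDegree W F i d) {s : ℤ} (hs : edge W s = .star) :
    IsEssentiallyUnary (cycle W) k f := by
  have f_eq : ∀ v, f v = residue W (F 0 + d * (v i : ℕ)) := by
    intro v
    rw [← eq_zero_add_mul_of_degree_ne_zero hF.isHom hd hdeg hs fun j => ((v j : ℕ) : ℤ),
      hF.residue_apply]
    simp only [residue_coe]
  exact ⟨i, fun u => f fun _ => u, fun u v huv => hf _ _ fun _ => huv, fun x =>
    (f_eq x).trans (f_eq fun _ => x i).symm⟩

theorem HasDegree.apply_eq_of_residue_eq (hdeg : ∀ i, HasDegree W F i 0) {x y : Fin k → ℤ}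
    (hxy : ∀ i, residue W (x i) = residue W (y i)) : F y = F x := by
  have update_add_mul : ∀ x i t (m : ℤ),
      F (Function.update x i (t + m * W.length)) = F (Function.update x i t) := by
    intro x i t m
    have h_succ : ∀ m : ℤ, F (Function.update x i (t + (m + 1) * W.length)) =
        F (Function.update x i (t + m * W.length)) := fun m => by
      rw [add_one_mul, ← add_assoc, hdeg i, mul_zero, add_zero]
    induction m using Int.induction_on with
    | zero => rw [zero_mul, add_zero]
    | succ j ih => rw [h_succ, ih]
    | pred j ih => rw [← ih, ← h_succ, sub_add_cancel]
  refine eq_of_forall_update (r := fun a b => residue W a = residue W b) (fun x i t h => ?_) hxy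
  obtain ⟨m, hm⟩ := residue_eq_iff.1 h
  rw [show t = x i + m * W.length by linarith, update_add_mul, Function.update_eq_self]

theorem IsLift.exists_hom_of_degree_zero (hF : IsLift f F) (hdeg : ∀ i, HasDegree W F i 0) :
    ∃ H : (Fin k → Fin W.length) → ℤ, IsHom (power (cycle W) k) (cover W) H ∧
      ∀ v, residue W (H v) = f v := by
  refine ⟨fun v => F fun j => ((v j : ℕ) : ℤ), fun u v huv => ?_, fun v => ?_⟩
  · have exists_coord : ∀ j, ∃ b, (cover W).Adj (u j : ℕ) b ∧ residue W b = v j := fun j =>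
      exists_cover_adj (by rw [residue_coe]; exact huv j)
    choose y hy hyv using exists_coord
    have F_eq : F (fun j => ((v j : ℕ) : ℤ)) = F y :=
      HasDegree.apply_eq_of_residue_eq hdeg fun j => by rw [residue_coe, hyv]
    simpa only [F_eq] using hF.isHom _ _ hy
  · simp only [hF.residue_apply, residue_coe]

end Degree

section Zigzag

variable {V V' : Type*} {G : Digraph V} {H : Digraph V'} {φ χ ψ φ' ψ' : ℤ} {x y z : V}

/-- A step from `x` to `y` at time `t` of a zigzag walk, which follows an arc forwards at even
times and backwards at odd times. -/
def Step (G : Digraph V) (t : ℤ) (x y : V) : Prop :=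
  if Even t then G.Adj x y else G.Adj y x

/-- There is a zigzag walk that is at `x` at time `φ` and at `y` at time `ψ`. -/
def Reaches (G : Digraph V) (φ ψ : ℤ) (x y : V) : Prop :=
  φ ≤ ψ ∧ ∃ p : ℤ → V, p φ = x ∧ p ψ = y ∧ ∀ t, φ ≤ t → t < ψ → Step G t (p t) (p (t + 1))

theorem step_refl (hG : ∀ v, G.Adj v v) (t : ℤ) (x : V) : Step G t x x := by
  unfold Step
  split_ifs <;> exact hG x

theorem step_add_one_iff {t : ℤ} : Step G (t + 1) x y ↔ Step G t y x := by
  by_cases ht : Even t <;> simp [Step, ht]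

theorem step_sub_iff {c t : ℤ} (hc : Even c) : Step G (c - t) x y ↔ Step G t x y := by
  simp [Step, Int.even_sub, hc]

theorem Reaches.map {f : V → V'} (hf : IsHom G H f) (h : Reaches G φ ψ x y) :
    Reaches H φ ψ (f x) (f y) := by
  obtain ⟨hφψ, p, rfl, rfl, hp⟩ := h
  refine ⟨hφψ, f ∘ p, rfl, rfl, fun t hφt htψ => ?_⟩
  have h_step := hp t hφt htψ
  unfold Step at h_step ⊢
  split_ifs at h_step ⊢ <;> exact hf _ _ h_step

theorem Reaches.pi {k : ℕ} {x y : Fin k → V} (hφψ : φ ≤ ψ)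
    (h : ∀ i, Reaches G φ ψ (x i) (y i)) : Reaches (power G k) φ ψ x y := by
  choose _ p hpφ hpψ hp using h
  refine ⟨hφψ, fun t i => p i t, funext hpφ, funext hpψ, fun t hφt htψ => ?_⟩
  have h_step := fun i => hp i t hφt htψ
  unfold Step at h_step ⊢
  split_ifs at h_step ⊢ <;> exact h_step

theorem Reaches.stay (hG : ∀ v, G.Adj v v) (hφψ : φ ≤ ψ) (x : V) : Reaches G φ ψ x x :=
  ⟨hφψ, fun _ => x, rfl, rfl, fun t _ _ => step_refl hG t x⟩

theorem reaches_succ_iff : Reaches G φ (φ + 1) x y ↔ Step G φ x y := by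
  refine ⟨fun ⟨_, p, hpφ, hpψ, hp⟩ => ?_, fun h => ?_⟩
  · rw [← hpφ, ← hpψ]
    exact hp φ le_rfl (lt_add_one φ)
  · refine ⟨by omega, fun t => if t ≤ φ then x else y, by simp, by simp, fun t hφt htψ => ?_⟩
    obtain rfl : t = φ := by omega
    simpa using h

theorem Reaches.trans (hxy : Reaches G φ χ x y) (hyz : Reaches G χ ψ y z) :
    Reaches G φ ψ x z := by
  obtain ⟨hφχ, p, hpφ, hpχ, hp⟩ := hxy
  obtain ⟨hχψ, q, hqχ, hqψ, hq⟩ := hyz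
  refine ⟨hφχ.trans hχψ, fun t => if t < χ then p t else q t, ?_, by simpa [hχψ.not_gt],
    fun t hφt htψ => ?_⟩
  · rcases hφχ.lt_or_eq with h | rfl
    · simpa [h]
    · simp [hqχ, ← hpχ, hpφ]
  · rcases lt_trichotomy (t + 1) χ with ht | rfl | ht
    · simpa [ht, show t < χ by omega] using hp t hφt (by omega)
    · simpa [hqχ, ← hpχ] using hp t hφt (by omega)
    · simpa [show ¬ t + 1 < χ by omega, show ¬ t < χ by omega] using hq t (by omega) htψ

theorem Reaches.exists_mid (h : Reaches G φ ψ x z) (hφχ : φ ≤ χ) (hχψ : χ ≤ ψ) :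
    ∃ y, Reaches G φ χ x y ∧ Reaches G χ ψ y z := by
  obtain ⟨-, p, hpφ, hpψ, hp⟩ := h
  exact ⟨p χ, ⟨hφχ, p, hpφ, rfl, fun t hφt htχ => hp t hφt (by omega)⟩,
    ⟨hχψ, p, rfl, hpψ, fun t hχt htψ => hp t (by omega) htψ⟩⟩

theorem Reaches.mono (hG : ∀ v, G.Adj v v) (h : Reaches G φ ψ x y) (hφ : φ' ≤ φ)
    (hψ : ψ ≤ ψ') : Reaches G φ' ψ' x y :=
  ((stay hG hφ x).trans h).trans (stay hG hψ y)

theorem Reaches.reflect {c : ℤ} (hc : Even c) (h : Reaches G φ ψ x y) :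
    Reaches G (c - ψ) (c - φ) y x := by
  obtain ⟨hφψ, p, rfl, rfl, hp⟩ := h
  refine ⟨by omega, fun t => p (c - t), by simp, by simp, fun t hψt htφ => ?_⟩
  have h_step := hp (c - (t + 1)) (by omega) (by omega)
  rwa [step_sub_iff hc, step_add_one_iff, show c - (t + 1) + 1 = c - t by ring] at h_step

theorem Reaches.reverse_of_lt (hG : ∀ v, G.Adj v v) (h : Reaches G φ ψ x y)
    (hlt : ψ - φ < ψ' - φ') : Reaches G φ' ψ' y x := by
  rcases Int.even_or_odd (φ' + ψ) with hc | hc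
  · exact (h.reflect hc).mono hG (by omega) (by omega)
  · exact (h.reflect hc.add_one).mono hG (by omega) (by omega)

theorem Reaches.of_lt (hG : ∀ v, G.Adj v v) (h : Reaches G φ ψ x y)
    (hlt : ψ - φ < ψ' - φ') : Reaches G φ' ψ' x y :=
  (h.reflect Even.zero).reverse_of_lt hG (by omega)

theorem Reaches.exists_first (h : Reaches G φ ψ x y) (hxy : x ≠ y) :
    ∃ χ, ¬ Reaches G φ χ x y ∧ Reaches G φ (χ + 1) x y := by
  by_contra! h_succ
  have hφψ := h.1
  induction ψ, hφψ using Int.leInduction with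
  | base =>
    obtain ⟨-, p, hpx, hpy, -⟩ := h
    exact hxy (hpx.symm.trans hpy)
  | succ ψ _ ih => exact h_succ ψ ih h

end Zigzag

section CoverZigzag

variable {W : Word} [NeZero W.length] {φ ψ s a b c : ℤ}

theorem abs_sub_le_of_step {t : ℤ} (h : Step (cover W) t a b) : |b - a| ≤ 1 := by
  unfold Step at h
  split_ifs at h
  · exact abs_sub_le_of_cover h
  · rw [abs_sub_comm]
    exact abs_sub_le_of_cover h

theorem step_succ_or (t a : ℤ) :
    Step (cover W) t a (a + 1) ∨ Step (cover W) (t + 1) a (a + 1) := by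
  rw [step_add_one_iff]
  unfold Step
  split_ifs
  · exact cover_adj_succ a
  · exact (cover_adj_succ a).symm

theorem step_succ_and_iff {t : ℤ} :
    Step (cover W) t a (a + 1) ∧ Step (cover W) (t + 1) a (a + 1) ↔ edge W a = .star := by
  rw [step_add_one_iff, ← cover_adj_succ_and_iff]
  unfold Step
  split_ifs
  · rfl
  · exact and_comm

theorem Reaches.abs_sub_le (h : Reaches (cover W) φ ψ a b) : |b - a| ≤ ψ - φ := by
  obtain ⟨hφψ, p, rfl, rfl, hp⟩ := h
  exact abs_sub_le_of_abs_step_le hφψ fun t hφt htψ => abs_sub_le_of_step (hp t hφt htψ)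

theorem isHom_min (c : ℤ) : IsHom (cover W) (cover W) (min c) := by
  intro a b h
  have h_abs := abs_sub_le_of_cover h
  by_cases hc : a ≤ c ∧ b ≤ c
  · rwa [min_eq_right hc.1, min_eq_right hc.2]
  · rw [abs_le] at h_abs
    exact Or.inl (by omega)

theorem isHom_max (c : ℤ) : IsHom (cover W) (cover W) (max c) := by
  intro a b h
  have h_abs := abs_sub_le_of_cover h
  by_cases hc : c ≤ a ∧ c ≤ b
  · rwa [max_eq_right hc.1, max_eq_right hc.2]
  · rw [abs_le] at h_abs
    exact Or.inl (by omega)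

theorem Reaches.right_of_le (h : Reaches (cover W) φ ψ a b) (hac : a ≤ c) (hcb : c ≤ b) :
    Reaches (cover W) φ ψ a c := by
  simpa only [min_eq_right hac, min_eq_left hcb] using h.map (isHom_min c)

theorem Reaches.right_of_ge (h : Reaches (cover W) φ ψ a b) (hbc : b ≤ c) (hca : c ≤ a) :
    Reaches (cover W) φ ψ a c := by
  simpa only [max_eq_left hbc, max_eq_right hca] using h.map (isHom_max c)

theorem Reaches.left_of_le (h : Reaches (cover W) φ ψ a b) (hac : a ≤ c) (hcb : c ≤ b) :
    Reaches (cover W) φ ψ c b := by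
  simpa only [max_eq_left hac, max_eq_right hcb] using h.map (isHom_max c)

theorem Reaches.left_of_ge (h : Reaches (cover W) φ ψ a b) (hbc : b ≤ c) (hca : c ≤ a) :
    Reaches (cover W) φ ψ c b := by
  simpa only [min_eq_right hbc, min_eq_left hca] using h.map (isHom_min c)

theorem Reaches.pred_right (h : Reaches (cover W) φ (ψ + 1) a b) (hab : a < b) :
    Reaches (cover W) φ ψ a (b - 1) := by
  have h_len := h.abs_sub_le
  rw [abs_le] at h_len
  obtain ⟨c, hac, hcb⟩ := h.exists_mid (χ := ψ) (by omega) (by omega)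
  have h_last := abs_sub_le_of_step (reaches_succ_iff.1 hcb)
  rw [abs_le] at h_last
  exact hac.right_of_le (by omega) (by omega)

theorem Reaches.succ_left (h : Reaches (cover W) φ ψ a b) (hab : a < b) :
    Reaches (cover W) (φ + 1) ψ (a + 1) b := by
  have h_len := h.abs_sub_le
  rw [abs_le] at h_len
  obtain ⟨c, hac, hcb⟩ := h.exists_mid (χ := φ + 1) (by omega) (by omega)
  have h_first := abs_sub_le_of_step (reaches_succ_iff.1 hac)
  rw [abs_le] at h_first
  exact hcb.left_of_le (by omega) (by omega)

theorem reaches_of_two_mul_le (hab : a ≤ b) (hlen : 2 * (b - a) ≤ ψ - φ) :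
    Reaches (cover W) φ ψ a b := by
  induction b, hab using Int.leInduction generalizing ψ with
  | base => exact Reaches.stay cover_refl (by omega) a
  | succ b _ ih =>
    rcases step_succ_or (W := W) (ψ - 2) b with h | h <;>
    exact ((ih (by omega)).trans (reaches_succ_iff.2 h)).mono cover_refl le_rfl (by omega)

theorem reaches_pred_of_add_two_le (hlen : φ + 2 ≤ ψ) : Reaches (cover W) φ ψ a (a - 1) := by
  have h : Reaches (cover W) (0 - ψ) (0 - φ) (a - 1) a :=
    reaches_of_two_mul_le (by omega) (by omega)
  simpa only [sub_sub_cancel] using h.reflect Even.zero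

theorem reaches_right_of_star (hab : a ≤ b) (hlen : b - a ≤ ψ - φ)
    (hstar : ∀ c, a ≤ c → c < b → edge W c = .star) : Reaches (cover W) φ ψ a b := by
  induction b, hab using Int.leInduction generalizing ψ with
  | base => exact Reaches.stay cover_refl (by omega) a
  | succ b hab ih =>
    have h_init := ih (ψ := ψ - 1) (by omega) fun c hac hcb => hstar c hac (by omega)
    have h_last := (step_succ_and_iff (t := ψ - 1)).2 (hstar b hab (by omega))
    simpa only [sub_add_cancel] using h_init.trans (reaches_succ_iff.2 h_last.1)

theorem reaches_left_of_star (hab : a ≤ b) (hlen : b - a ≤ ψ - φ)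
    (hstar : ∀ c, a ≤ c → c < b → edge W c = .star) : Reaches (cover W) φ ψ b a := by
  have h : Reaches (cover W) (0 - ψ) (0 - φ) a b := reaches_right_of_star hab (by omega) hstar
  simpa only [sub_sub_cancel] using h.reflect Even.zero

/-- A walk that hurries to the blocked edge has to wait there, so it may as well start late. -/
theorem Reaches.start_late {e : ℤ} (h : Reaches (cover W) φ ψ s b) (hse : s ≤ e) (heb : e < b)
    (hstar : ∀ c, s ≤ c → c < e → edge W c = .star)
    (hblocked : ¬ Step (cover W) (φ + (e - s)) e (e + 1)) : Reaches (cover W) (φ + 1) ψ s b := by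
  have h_len := h.abs_sub_le
  rw [abs_le] at h_len
  obtain ⟨c, hsc, hcb⟩ := h.exists_mid (χ := φ + (e - s)) (by omega) (by omega)
  obtain ⟨d, hcd, hdb⟩ := hcb.exists_mid (χ := φ + (e - s) + 1) (by omega) (by omega)
  have d_le : d ≤ e := by
    rw [reaches_succ_iff] at hcd
    have hc := hsc.abs_sub_le
    have hd := abs_sub_le_of_step hcd
    rw [abs_le] at hc hd
    by_contra! hlt
    obtain rfl : c = e := by omega
    obtain rfl : d = c + 1 := by omega
    exact hblocked hcd
  have h_prefix : Reaches (cover W) (φ + 1) (φ + (e - s) + 1) s e :=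
    reaches_right_of_star hse (by omega) hstar
  exact h_prefix.trans (hdb.left_of_le d_le heb.le)

theorem exists_reaches_ends (hφψ : φ + 2 ≤ ψ) (hbs : b = s + W.length - 1)
    (h_right : Reaches (cover W) φ ψ s (b - 1)) (h_right' : Reaches (cover W) φ ψ (s + 1) b)
    (h_left : Reaches (cover W) φ ψ (b - 1) s) (h_left' : Reaches (cover W) φ ψ b (s + 1))
    (hsa : s ≤ a) (hab : a ≤ b) :
    ∃ l r : ℤ, l + W.length ≤ r + 1 ∧
      Reaches (cover W) φ ψ a l ∧ Reaches (cover W) φ ψ a r := by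
  rcases hsa.eq_or_lt with rfl | hsa'
  · exact ⟨s - 1, b - 1, by omega, reaches_pred_of_add_two_le hφψ, h_right⟩
  rcases hab.eq_or_lt with rfl | hab'
  · exact ⟨s + 1, a + 1, by omega, h_left', reaches_of_two_mul_le (by omega) (by omega)⟩
  · exact ⟨s, b, by omega, h_left.left_of_ge hsa (by omega),
      h_right'.left_of_le (by omega) hab⟩

theorem reaches_cycle_of_reaches_cover (hφψ : φ + 2 ≤ ψ) (hbs : b = s + W.length - 1)
    (h_right : Reaches (cover W) φ ψ s (b - 1)) (h_right' : Reaches (cover W) φ ψ (s + 1) b)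
    (h_left : Reaches (cover W) φ ψ (b - 1) s) (h_left' : Reaches (cover W) φ ψ b (s + 1))
    (u v : Fin W.length) : Reaches (cycle W) φ ψ u v := by
  obtain ⟨a, hsa, has, rfl⟩ := exists_residue_eq s u
  obtain ⟨l, r, hlr, hl, hr⟩ :=
    exists_reaches_ends hφψ hbs h_right h_right' h_left h_left' hsa (by omega)
  obtain ⟨c, hlc, hcl, rfl⟩ := exists_residue_eq l v
  refine Reaches.map isHom_residue ?_
  rcases le_total c a with hca | hac
  · exact hl.right_of_ge hlc hca
  · exact hr.right_of_le hac (by omega)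

theorem exists_zigzag_of_star (hW : 4 ≤ W.length)
    (hstar : ∀ c, s ≤ c → c < s + W.length - 1 → edge W c = .star) :
    ∃ φ ψ, φ ≤ ψ ∧ (∀ u v, Reaches (cycle W) φ ψ u v) ∧
      ¬ Reaches (cover W) φ ψ s (s + W.length - 1) := by
  refine ⟨0, W.length - 2, by omega,
    reaches_cycle_of_reaches_cover (s := s) (by omega) rfl ?_ ?_ ?_ ?_, fun h => ?_⟩
  · exact reaches_right_of_star (by omega) (by omega) fun c _ _ => hstar c (by omega) (by omega)
  · exact reaches_right_of_star (by omega) (by omega) fun c _ _ => hstar c (by omega) (by omega)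
  · exact reaches_left_of_star (by omega) (by omega) fun c _ _ => hstar c (by omega) (by omega)
  · exact reaches_left_of_star (by omega) (by omega) fun c _ _ => hstar c (by omega) (by omega)
  · have h_len := h.abs_sub_le
    rw [abs_le] at h_len
    omega

theorem exists_zigzag_of_blocked (hW : 4 ≤ W.length) {e : ℤ} (hse : s ≤ e)
    (hes : e < s + W.length - 1) (hstar : ∀ c, s ≤ c → c < e → edge W c = .star)
    (hblocked : ¬ Step (cover W) (φ + (e - s)) e (e + 1)) :
    ∃ ψ, φ ≤ ψ ∧ (∀ u v, Reaches (cycle W) φ ψ u v) ∧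
      ¬ Reaches (cover W) φ ψ s (s + W.length - 1) := by
  set b := s + (W.length : ℤ) - 1 with hb
  have h_exists : Reaches (cover W) φ (φ + 2 * (b - s)) s b :=
    reaches_of_two_mul_le (by omega) (by omega)
  obtain ⟨ψ, h_not, h_first⟩ := h_exists.exists_first (by omega)
  have h_len := h_first.abs_sub_le
  rw [abs_le] at h_len
  have h_late : Reaches (cover W) (φ + 1) (ψ + 1) s b :=
    h_first.start_late hse hes hstar hblocked
  have h_trimmed : Reaches (cover W) (φ + 1 + 1) (ψ + 1) (s + 1) b := h_late.succ_left (by omega)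
  refine ⟨ψ, by omega, reaches_cycle_of_reaches_cover (by omega) hb ?_ ?_ ?_ ?_, h_not⟩
  · exact h_first.pred_right (by omega)
  · exact h_trimmed.of_lt cover_refl (by omega)
  · exact (h_late.pred_right (by omega)).reverse_of_lt cover_refl (by omega)
  · exact h_trimmed.reverse_of_lt cover_refl (by omega)

theorem exists_zigzag (hW : 4 ≤ W.length) (s : ℤ) :
    ∃ φ ψ, φ ≤ ψ ∧ (∀ u v, Reaches (cycle W) φ ψ u v) ∧
      ¬ Reaches (cover W) φ ψ s (s + W.length - 1) := by
  by_cases h_all : ∀ c, s ≤ c → c < s + W.length - 1 → edge W c = .star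
  · exact exists_zigzag_of_star hW h_all
  push Not at h_all
  obtain ⟨c, hsc, hcs, hc⟩ := h_all
  obtain ⟨e, ⟨hse, he⟩, h_least⟩ := Int.exists_least_of_bdd
    (P := fun a => s ≤ a ∧ edge W a ≠ .star) ⟨s, fun _ h => h.1⟩ ⟨c, hsc, hc⟩
  have h_star : ∀ a, s ≤ a → a < e → edge W a = .star := fun a hsa hae => by
    by_contra ha
    exact hae.not_ge (h_least a ⟨hsa, ha⟩)
  obtain ⟨t, ht⟩ : ∃ t, ¬ Step (cover W) t e (e + 1) := by
    by_contra! h_step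
    exact he (step_succ_and_iff.1 ⟨h_step 0, h_step 1⟩)
  exact ⟨t - (e - s), exists_zigzag_of_blocked hW hse ((h_least c ⟨hsc, hc⟩).trans_lt hcs) h_star
    (by rwa [sub_add_cancel])⟩

end CoverZigzag

theorem not_surjective_residue_comp {W : Word} [NeZero W.length] (hW : 4 ≤ W.length) {k : ℕ}
    {H : (Fin k → Fin W.length) → ℤ} (hH : IsHom (power (cycle W) k) (cover W) H) :
    ¬ Function.Surjective fun v => residue W (H v) := by
  intro h_surj
  obtain ⟨x, hx⟩ := Finite.exists_min H
  obtain ⟨φ, ψ, hφψ, h_cycle, h_cover⟩ := exists_zigzag hW (H x)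
  obtain ⟨y, hy⟩ := h_surj (residue W (H x + W.length - 1))
  have hxy := hx y
  have h_far : H x + W.length - 1 ≤ H y := by
    by_contra! hlt
    exact hlt.ne (eq_of_residue_eq hy (by rw [abs_lt]; omega))
  refine h_cover (((Reaches.pi hφψ fun i => h_cycle (x i) (y i)).map hH).right_of_le ?_ h_far)
  omega

theorem _root_.theorem5p4_general (W : Word) (hW : 4 ≤ W.length) (hstar : Letter.star ∈ W) :
    IsSlupecki (cycle W) := by
  intro k f _ hf h_surj
  have : NeZero W.length := ⟨by omega⟩
  obtain ⟨F, hF⟩ := exists_isLift hW hf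
  choose d hd using hF.exists_degree (by omega)
  by_cases h_zero : ∀ i, d i = 0
  · obtain ⟨H, hH, hHf⟩ := hF.exists_hom_of_degree_zero fun i => h_zero i ▸ hd i
    exact absurd (by simpa only [hHf] using h_surj) (not_surjective_residue_comp hW hH)
  · push Not at h_zero
    obtain ⟨i, hi⟩ := h_zero
    obtain ⟨u, hu⟩ := List.mem_iff_get.1 hstar
    exact hF.isEssentiallyUnary hf hi (hd i) (s := (u : ℕ)) (by rw [edge, residue_coe, hu])

end Slupecki

theorem theorem5p4 (k : ℕ) (hk : 3 ≤ k) (P : Digraph (Fin (k + 1)))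
    (hP : Slupecki.IsPath P) (hdual : Slupecki.IsSelfDual P)
    (hsym : 2 ≤ Slupecki.numSymmetricEdges P) :
    Slupecki.IsSlupecki
      (Slupecki.cycle (Slupecki.pathWord P ++ [Slupecki.Letter.plus])) :=
  theorem5p4_general _ (by simpa [Slupecki.pathWord] using hk)
    (List.mem_append_left _ (List.count_pos_iff.1 (two_pos.trans_le hsym)))
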